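/- Let $\Omega=\{0,1\}^{\mathbb N}$ be the Cantor space, write $[a]\subset\Omega$ for the set of all infinite extensions of a finite binary string $a$, let $P$ be a computable probability measure on $\Omega\times\Omega$ (the values $P([a]\times[b])$ are computable reals uniformly in $a,b$), and let $P_1$ be its marginal distribution on the first coordinate. For $\alpha\in\Omega$ the conditional distribution $P(\cdot\,|\,\alpha)$ is the measure on $\Omega$ with $$P([b]\,|\,\alpha)=\lim_{n\to\infty}\frac{P([a_n]\times[b])}{P_1([a_n])}\quad\text{for all finite strings } b,$$ where $a_n$ is the prefix of $\alpha$ of length $n$ and all $P_1([a_n])$ are required to be positive; it is unique if it exists. (It exists for every $P_1$-random $\alpha$; where it does not exist, no sequence is regarded as random with respect to it.) A test with respect to a measure $\mu$ (with oracle $\alpha$) is a sequence of open sets $U_n$, effectively open (with oracle $\alpha$) uniformly in $n$, such that $\mu(U_n)\le 2^{-n}$ for all $n$; no access to $\mu$ is given. A point is $\mu$-random if for every such test it lies outside $\bigcap_n U_n$. For a computable $\mu$ and no oracle this is Martin-Löf randomness; for an arbitrary, possibly noncomputable, $\mu$ it is called blind (Hippocratic) randomness. Theorem. Let $\alpha_1,\alpha_2\in\Omega$.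 If $\alpha_1$ is Martin-Löf random with respect to $P_1$, and $\alpha_2$ is blind (Hippocratic) random with oracle $\alpha_1$ with respect to the conditional distribution $P(\cdot\,|\,\alpha_1)$, then the pair $(\alpha_1,\alpha_2)$ is Martin-Löf random with respect to $P$. -/

import Mathlib

open MeasureTheory Filter Topology
open scoped ENNReal

namespace VanLambalgen

/-- The Cantor space of infinite binary sequences. -/
abbrev Cantor : Type := ℕ → Bool

/-- The interval `[a]`: all infinite sequences that extend the finite string `a`. -/
def cyl (a : List Bool) : Set Cantor := {α | ∀ (i : ℕ) (h : i < a.length), α i = a[i]}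

/-- The product `[a] × [b]` of two intervals. -/
def box (p : List Bool × List Bool) : Set (Cantor × Cantor) := cyl p.1 ×ˢ cyl p.2

/-- The prefix of length `n` of an infinite sequence. -/
def initSeg (α : Cantor) (n : ℕ) : List Bool := List.ofFn fun i : Fin n => α i

/-- An infinite binary sequence regarded as an oracle `ℕ → ℕ` with values `0` and `1`. -/
def oracle (α : Cantor) : ℕ →. ℕ := fun n => Part.some (α n).toNat

/-- `p` is enumerable with oracles in `O`: it is the domain of a partial function that is
recursive in `O`. -/
def REPredIn {ι : Type} [Primcodable ι] (O : Set (ℕ →. ℕ)) (p : ι → Prop) : Prop :=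
  RecursiveIn O fun i => Part.assert (p i) fun _ => Part.some ()

/-- The `n`-th member of the family of open sets that is given by a set `W` of pairs
(index, basic set); the family is uniformly effectively open if `W` is enumerable. -/
def openSet {X ι : Type} (B : ι → Set X) (W : ℕ × ι → Prop) (n : ℕ) : Set X :=
  {x | ∃ i, W (n, i) ∧ x ∈ B i}

/-- Martin-Löf tests with oracles in `O` for an arbitrary (not necessarily computable) measure
`μ`, where `B` lists the basic open sets of the space: the sets `openSet B W n` are
effectively open with oracles in `O`, uniformly in `n`, without any access to `μ`. -/
structure IsTest {X ι : Type} [MeasurableSpace X] [Primcodable ι] (B : ι → Set X)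
    (O : Set (ℕ →. ℕ)) (μ : Measure X) (W : ℕ × ι → Prop) : Prop where
  enumerable : REPredIn O W
  measure_le : ∀ n, μ (openSet B W n) ≤ (2⁻¹ : ℝ≥0∞) ^ n

/-- `x` passes all tests with oracles in `O`. For a measure that is computable this
is Martin-Löf randomness with oracles in `O`; for an arbitrary measure this is blind
(Hippocratic) randomness with oracles in `O`. -/
def IsRandom {X ι : Type} [MeasurableSpace X] [Primcodable ι] (B : ι → Set X)
    (O : Set (ℕ →. ℕ)) (μ : Measure X) (x : X) : Prop :=
  ∀ W : ℕ × ι → Prop, IsTest B O μ W → ∃ n, x ∉ openSet B W n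

/-- Martin-Löf randomness of a sequence (without oracle). -/
def MLRandom (μ : Measure Cantor) (α : Cantor) : Prop := IsRandom cyl ∅ μ α

/-- Martin-Löf randomness of a pair of sequences (without oracle). -/
def MLRandomPair (P : Measure (Cantor × Cantor)) (p : Cantor × Cantor) : Prop :=
  IsRandom box ∅ P p

/-- Blind (Hippocratic) randomness of `β` with respect to `μ`, with oracle `α`. -/
def BlindRandom (α : Cantor) (μ : Measure Cantor) (β : Cantor) : Prop :=
  IsRandom cyl {oracle α} μ β

/-- A measure on pairs of sequences is computable if the measures of the products of intervals
are computable reals, uniformly: an algorithm produces, given `a`, `b` and `n`, the numerator of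
a fraction with denominator `2 ^ n` that is `2 ^ (-n)`-close to the measure of `[a] × [b]`. -/
def ComputableMeasure (P : Measure (Cantor × Cantor)) : Prop :=
  ∃ f : (List Bool × List Bool) × ℕ → ℕ, Computable f ∧
    ∀ p n, |(P (box p)).toReal - (f (p, n) : ℝ) / 2 ^ n| ≤ 1 / 2 ^ n

/-- `Q` is the conditional distribution on the second coordinate with the condition that the first
coordinate equals `α`: all prefixes `a` of `α` have positive probability, and
`Q [b] = lim P ([a] × [b]) / P ([a] × Ω)` for every string `b`, as the length of the prefix `a`
of `α` tends to infinity. (The marginal distribution on the first coordinate is `P.fst`.) -/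
structure IsCondMeasure (P : Measure (Cantor × Cantor)) (α : Cantor) (Q : Measure Cantor) :
    Prop where
  pos : ∀ n, 0 < P.fst (cyl (initSeg α n))
  tendsto : ∀ b : List Bool,
    Tendsto (fun n => P (box (initSeg α n, b)) / P.fst (cyl (initSeg α n))) atTop
      (𝓝 (Q (cyl b)))

open Classical in
/-- The conditional distribution `P(· | α)`. It is determined by `IsCondMeasure`, see
`condMeasure_eq`; where the limit distribution does not exist, the value is the zero measure,
and no sequence is random with respect to it, see `not_blindRandom_zero`. -/
noncomputable def condMeasure (P : Measure (Cantor × Cantor)) (α : Cantor) : Measure Cantor :=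
  if h : ∃ Q, IsCondMeasure P α Q then h.choose else 0

theorem cyl_nil : cyl [] = Set.univ := by
  ext α; simp [cyl]

theorem measurableSet_cyl (a : List Bool) : MeasurableSet (cyl a) := by
  have : cyl a = ⋂ (i : ℕ) (h : i < a.length), (fun α : Cantor => α i) ⁻¹' {a[i]} := by
    ext α; simp [cyl]
  rw [this]
  exact MeasurableSet.iInter fun i => MeasurableSet.iInter fun h =>
    measurable_pi_apply i (measurableSet_singleton _)

theorem cyl_inter {a b : List Bool} (hab : a.length ≤ b.length) (h : (cyl a ∩ cyl b).Nonempty) :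
    cyl a ∩ cyl b = cyl b := by
  obtain ⟨α, ha, hb⟩ := h
  refine Set.inter_eq_right.2 fun β hβ i hi => ?_
  rw [hβ i (hi.trans_le hab), ← hb i (hi.trans_le hab), ha i hi]

theorem isPiSystem_cyl : IsPiSystem (Set.range cyl) := by
  rintro _ ⟨a, rfl⟩ _ ⟨b, rfl⟩ h
  rcases le_total a.length b.length with hab | hab
  · exact ⟨b, (cyl_inter hab h).symm⟩
  · rw [Set.inter_comm] at h ⊢
    exact ⟨a, (cyl_inter hab h).symm⟩

theorem mem_cyl_initSeg (α : Cantor) (n : ℕ) : α ∈ cyl (initSeg α n) := by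
  intro i h; simp [initSeg]

theorem generateFrom_cyl :
    (inferInstance : MeasurableSpace Cantor) = MeasurableSpace.generateFrom (Set.range cyl) := by
  refine le_antisymm (iSup_le fun i => ?_) ?_
  · rintro _ ⟨s, -, rfl⟩
    have : (fun α : Cantor => α i) ⁻¹' s =
        ⋃ (a : List Bool) (_ : ∃ α : Cantor, a = initSeg α (i + 1) ∧ α i ∈ s), cyl a := by
      ext β
      simp only [Set.mem_preimage, Set.mem_iUnion, exists_prop]
      constructor
      · exact fun h => ⟨_, ⟨β, rfl, h⟩, mem_cyl_initSeg β _⟩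
      · rintro ⟨_, ⟨α, rfl, h⟩, hβ⟩
        have := hβ i (by simp [initSeg])
        have e : (initSeg α (i + 1))[i]'(by simp [initSeg]) = α i :=
          List.getElem_ofFn _
        rw [this, e]
        exact h
    rw [this]
    exact MeasurableSet.biUnion (Set.to_countable _) fun a _ =>
      MeasurableSpace.measurableSet_generateFrom ⟨a, rfl⟩
  · refine MeasurableSpace.generateFrom_le ?_
    rintro _ ⟨a, rfl⟩
    exact measurableSet_cyl a

theorem IsCondMeasure.isProbabilityMeasure {P : Measure (Cantor × Cantor)}
    [IsProbabilityMeasure P] {α : Cantor} {Q : Measure Cantor} (h : IsCondMeasure P α Q) :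
    IsProbabilityMeasure Q := by
  refine ⟨?_⟩
  have h1 := h.tendsto []
  rw [cyl_nil] at h1
  refine tendsto_nhds_unique h1 (tendsto_const_nhds.congr fun n => ?_)
  have : P (box (initSeg α n, [])) = P.fst (cyl (initSeg α n)) := by
    rw [Measure.fst_apply (measurableSet_cyl _), box, cyl_nil, Set.prod_univ]
  rw [this, ENNReal.div_self (h.pos n).ne' (measure_ne_top _ _)]

theorem IsCondMeasure.unique {P : Measure (Cantor × Cantor)} [IsProbabilityMeasure P]
    {α : Cantor} {Q Q' : Measure Cantor} (h : IsCondMeasure P α Q) (h' : IsCondMeasure P α Q') :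
    Q = Q' := by
  have := h.isProbabilityMeasure
  have := h'.isProbabilityMeasure
  refine ext_of_generate_finite _ generateFrom_cyl isPiSystem_cyl ?_ (by simp)
  rintro _ ⟨b, rfl⟩
  exact tendsto_nhds_unique (h.tendsto b) (h'.tendsto b)

/-- `condMeasure P α` is the conditional distribution whenever there is one. -/
theorem condMeasure_eq {P : Measure (Cantor × Cantor)} [IsProbabilityMeasure P]
    {α : Cantor} {Q : Measure Cantor} (h : IsCondMeasure P α Q) : condMeasure P α = Q := by
  have hex : ∃ Q, IsCondMeasure P α Q := ⟨Q, h⟩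
  rw [condMeasure, dif_pos hex]
  exact hex.choose_spec.unique h

/-- No sequence is random with respect to the zero measure. -/
theorem not_blindRandom_zero (α β : Cantor) : ¬ BlindRandom α 0 β := by
  intro h
  have hre : REPredIn {oracle α} fun _ : ℕ × List Bool => True :=
    RecursiveIn.of_eq (ComputableIn.const ()).recursiveIn fun _ =>
      (Part.assert_pos (f := fun _ => Part.some ()) trivial).symm
  obtain ⟨n, hn⟩ := h (fun _ => True) ⟨hre, by simp⟩
  exact hn ⟨[], trivial, by simp [cyl_nil]⟩

end VanLambalgen

namespace VanLambalgen

/-! Let `U_i` be the sets of a test for `P`. Call a string `a` heavy for `n` if `U_{2n}` occupies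
more than a `2⁻ⁿ` fraction of `[a] × Ω`. The minimal heavy strings have disjoint cylinders, so the
heavy cylinders cover a set of `P₁`-measure at most `2ⁿ P(U_{2n}) ≤ 2⁻ⁿ`. Taking all `n > N`
together gives measure at most `2⁻ᴺ` (`measure_heavyString_le`). Since `P` is computable and the
inequality strict, heaviness is enumerable (`rePredIn_heavyString`), and this is a Martin-Löf test
for `P₁`.

Randomness of `α₁` provides an `N` such that no prefix of `α₁` is heavy for any `n > N`. The
relative measure of `U_{2n}` is thus at most `2⁻ⁿ` above every prefix, and in the limit the section
of `U_{2n}` at `α₁` has conditional measure at most `2⁻ⁿ` (`IsCondMeasure.measure_section_le`).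
These sections are enumerable from `α₁` (`rePredIn_section`), so they form a blind test; the
conditional measure itself is never computed. As `α₂` avoids some section, the pair avoids some
`U_{2n}`. -/

/-! ### Enumerability relative to an oracle -/

theorem computableIn_nat_iff {O : Set (ℕ →. ℕ)} {f : ℕ → ℕ} :
    ComputableIn O f ↔ Nat.RecursiveIn O fun n => Part.some (f n) :=
  RecursiveIn.iff_nat

theorem ComputableIn.comp_computable {ι κ σ : Type} [Primcodable ι] [Primcodable κ]
    [Primcodable σ] {O : Set (ℕ →. ℕ)} {f : κ → σ} {g : ι → κ} (hf : Computable f)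
    (hg : ComputableIn O g) : ComputableIn O fun x => f (g x) := by
  refine Nat.RecursiveIn.of_eq (Nat.RecursiveIn.comp (Nat.Partrec.recursiveIn hf) hg) fun n => ?_
  cases h : (Encodable.decode n : Option ι) <;> simp

theorem ComputableIn.comp {ι κ σ : Type} [Primcodable ι] [Primcodable κ]
    [Primcodable σ] {O : Set (ℕ →. ℕ)} {f : κ → σ} {g : ι → κ} (hf : ComputableIn O f)
    (hg : ComputableIn O g) : ComputableIn O fun x => f (g x) := by
  refine Nat.RecursiveIn.of_eq (Nat.RecursiveIn.comp hf hg) fun n => ?_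
  cases h : (Encodable.decode n : Option ι) <;> simp

theorem ComputableIn.prodMk {ι κ σ : Type} [Primcodable ι] [Primcodable κ]
    [Primcodable σ] {O : Set (ℕ →. ℕ)} {f : ι → κ} {g : ι → σ} (hf : ComputableIn O f)
    (hg : ComputableIn O g) : ComputableIn O fun x => (f x, g x) := by
  refine Nat.RecursiveIn.of_eq (Nat.RecursiveIn.pair hf hg) fun n => ?_
  cases h : (Encodable.decode n : Option ι) <;> simp [Seq.seq]

/-- A predicate is enumerable if it is a projection of a decidable relation. -/
theorem REPredIn.of_exists {ι : Type} [Primcodable ι] {O : Set (ℕ →. ℕ)} {p : ι → Prop}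
    {F : ι × ℕ → Bool} (hF : ComputableIn O F) (h : ∀ x, p x ↔ ∃ t, F (x, t) = true) :
    REPredIn O p := by
  -- Unbounded search looks for a zero, hence the negation.
  have hG : ComputableIn O fun y => (!F y).toNat :=
    ComputableIn.comp_computable (f := fun b : Bool => (!b).toNat)
      (Primrec.dom_finite _).to_comp hF
  have hz : Nat.RecursiveIn O fun _ => Part.some 0 := Nat.RecursiveIn.zero
  refine Nat.RecursiveIn.of_eq (Nat.RecursiveIn.comp hz (Nat.RecursiveIn.rfind hG)) fun n => ?_
  cases hn : (Encodable.decode n : Option ι) with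
  | none =>
    simp [hn, Nat.rfind_zero_none (fun _ => Part.none) rfl]
  | some x =>
    have key : ((Nat.rfind fun t => Part.some (F (x, t))).bind fun _ => Part.some 0) =
        Part.map Encodable.encode (Part.assert (p x) fun _ => Part.some ()) := by
      by_cases hx : p x
      · obtain ⟨t, ht⟩ := (h x).1 hx
        obtain ⟨m, hm, -⟩ := Nat.rfind_min' (p := fun t => F (x, t)) ht
        rw [Part.assert_pos hx]
        exact (congrArg (fun r : Part ℕ => r.bind fun _ => Part.some 0)
          (Part.eq_some_iff.2 hm)).trans (by simp)
      · rw [Part.assert_neg hx, Part.map_none, Part.eq_none_iff]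
        rintro v hv
        obtain ⟨m, hm, -⟩ := Part.mem_bind_iff.1 hv
        exact hx ((h x).2 ⟨m, (Part.mem_some_iff.1 (Nat.rfind_spec hm)).symm⟩)
    simpa [hn] using key

theorem REPredIn.of_exists_primcodable {ι τ : Type} [Primcodable ι] [Primcodable τ]
    {p : ι → Prop} {F : ι × τ → Bool} (hF : Computable F)
    (h : ∀ x, p x ↔ ∃ t, F (x, t) = true) : REPredIn ∅ p := by
  refine REPredIn.of_exists
    -- Numbers that code nothing get the value `false`, so they are never witnesses.
    (F := fun y => ((Encodable.decode y.2 : Option τ).map fun t => F (y.1, t)).getD false)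
    (Computable.computableIn ?_) fun x => ?_
  · exact Computable.option_getD (Computable.option_map (Computable.decode.comp Computable.snd)
      (hF.comp ((Computable.fst.comp Computable.fst).pair Computable.snd)).to₂)
      (Computable.const false)
  · rw [h]
    constructor
    · rintro ⟨t, ht⟩
      exact ⟨Encodable.encode t, by simpa using ht⟩
    · rintro ⟨n, hn⟩
      cases hd : (Encodable.decode n : Option τ) with
      | none => simp [hd] at hn
      | some t => exact ⟨t, by simpa [hd] using hn⟩

/-- Enumerable predicates are enumerated in computable stages. -/
theorem REPredIn.exists_stage {ι : Type} [Primcodable ι] {p : ι → Prop} (hp : REPredIn ∅ p) :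
    ∃ T : ι × ℕ → Bool, Computable T ∧ (∀ x, p x ↔ ∃ s, T (x, s) = true) ∧
      ∀ x s t, s ≤ t → T (x, s) = true → T (x, t) = true := by
  obtain ⟨c, hc⟩ := Nat.Partrec.Code.exists_code.1 (recursiveIn_empty_iff.1 hp)
  refine ⟨fun y => (Nat.Partrec.Code.evaln y.2 c (Encodable.encode y.1)).isSome, ?_, ?_, ?_⟩
  · exact (Primrec.option_isSome.comp (Nat.Partrec.Code.primrec_evaln.comp
      ((Primrec.snd.pair (Primrec.const c)).pair (Primrec.encode.comp Primrec.fst)))).to_comp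
  · intro x
    have : p x ↔ ∃ v, v ∈ c.eval (Encodable.encode x) := by
      rw [hc]; simp
    rw [this]
    simp only [Nat.Partrec.Code.evaln_complete, Option.isSome_iff_exists, Option.mem_def]
    exact exists_comm
  · intro x s t hst
    simp only [Option.isSome_iff_exists]
    exact fun ⟨v, hv⟩ => ⟨v, Nat.Partrec.Code.evaln_mono hst hv⟩

/-! ### Prefixes and cylinders -/

theorem initSeg_succ (α : Cantor) (n : ℕ) : initSeg α (n + 1) = initSeg α n ++ [α n] := by
  simp only [initSeg, List.ofFn_succ_last, Fin.val_castSucc, Fin.val_last]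

theorem computableIn_initSeg (α : Cantor) : ComputableIn {oracle α} (initSeg α) := by
  have ho : ComputableIn {oracle α} fun n => (α n).toNat :=
    computableIn_nat_iff.2 (Nat.RecursiveIn.oracle _ rfl)
  have hs : ComputableIn {oracle α} fun q : ℕ × (ℕ × List Bool) =>
      q.2.2 ++ [decide ((α q.2.1).toNat = 1)] := by
    refine ComputableIn.comp_computable (f := fun z : List Bool × ℕ => z.1 ++ [decide (z.2 = 1)])
      (g := fun q : ℕ × (ℕ × List Bool) => (q.2.2, (α q.2.1).toNat)) ?_ ?_
    · exact (Primrec.list_concat.comp Primrec.fst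
        (Primrec.eq.decide.comp Primrec.snd (Primrec.const 1))).to_comp
    · exact ComputableIn.prodMk (Primrec.snd.comp Primrec.snd).computableIn
        (ComputableIn.comp (f := fun n => (α n).toNat) ho
          (Primrec.fst.comp Primrec.snd).computableIn)
  have hz : Nat.RecursiveIn {oracle α} fun _ => Part.some 0 := Nat.RecursiveIn.zero
  have := Nat.RecursiveIn.prec hz hs
  -- Primitive recursion carries a parameter, which is not needed here and is fixed at `0`.
  have hp : Nat.RecursiveIn {oracle α} fun n => Part.some (Nat.pair 0 n) :=
    (computableIn_nat_iff.1 (Primrec₂.natPair.comp (Primrec.const 0) Primrec.id).computableIn)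
  refine Nat.RecursiveIn.of_eq (Nat.RecursiveIn.comp this hp) fun n => ?_
  simp
  induction n with
  | zero => simp [initSeg]
  | succ n ih =>
    simp [ih, initSeg_succ]

theorem length_initSeg (α : Cantor) (n : ℕ) : (initSeg α n).length = n := by simp [initSeg]

theorem mem_cyl_iff {α : Cantor} {a : List Bool} : α ∈ cyl a ↔ initSeg α a.length = a := by
  constructor
  · intro h
    refine List.ext_getElem (length_initSeg _ _) fun i h₁ h₂ => ?_
    simp [initSeg, h i h₂]
  · intro h
    rw [← h]
    exact mem_cyl_initSeg _ _

theorem take_initSeg (α : Cantor) {m n : ℕ} (h : m ≤ n) :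
    (initSeg α n).take m = initSeg α m := by
  refine List.ext_getElem (by simp [length_initSeg, h]) fun i h₁ h₂ => ?_
  simp [initSeg]

theorem cyl_subset_cyl_take (a : List Bool) (n : ℕ) : cyl a ⊆ cyl (a.take n) := by
  intro α h i hi
  rw [List.getElem_take]
  exact h i (by simp at hi; omega)

theorem cyl_initSeg_anti (α : Cantor) {m n : ℕ} (h : m ≤ n) :
    cyl (initSeg α n) ⊆ cyl (initSeg α m) := by
  rw [← take_initSeg α h]
  exact cyl_subset_cyl_take _ _

theorem disjoint_cyl {a b : List Bool} (hl : a.length = b.length) (h : a ≠ b) :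
    Disjoint (cyl a) (cyl b) := by
  refine Set.disjoint_left.2 fun α ha hb => h ?_
  rw [← mem_cyl_iff.1 ha, ← mem_cyl_iff.1 hb, hl]

/-- If `μ` is at most `ν` on each of a family of cylinders, then also on their union. -/
theorem measure_biUnion_cyl_le (μ ν : Measure Cantor) (S : Set (List Bool))
    (h : ∀ a ∈ S, μ (cyl a) ≤ ν (cyl a)) : μ (⋃ a ∈ S, cyl a) ≤ ν (⋃ a ∈ S, cyl a) := by
  -- The minimal strings of `S` have disjoint cylinders with the same union, so the inequality can
  -- be summed.
  set M : Set (List Bool) := {a | a ∈ S ∧ ∀ k < a.length, a.take k ∉ S} with hM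
  have hU : ⋃ a ∈ S, cyl a = ⋃ a ∈ M, cyl a := by
    refine subset_antisymm (fun α hα => ?_) (Set.biUnion_subset_biUnion_left fun a ha => ha.1)
    simp only [Set.mem_iUnion, exists_prop] at hα ⊢
    have hex : ∃ n, initSeg α n ∈ S := by
      obtain ⟨a, ha, hα⟩ := hα
      exact ⟨a.length, by rwa [mem_cyl_iff.1 hα]⟩
    classical
    refine ⟨initSeg α (Nat.find hex), ⟨Nat.find_spec hex, fun k hk => ?_⟩, mem_cyl_initSeg _ _⟩
    rw [length_initSeg] at hk
    rw [take_initSeg α hk.le]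
    exact Nat.find_min hex hk
  have hd : M.PairwiseDisjoint cyl := by
    intro a ha b hb hab
    refine Set.disjoint_left.2 fun α hαa hαb => hab ?_
    rw [mem_cyl_iff] at hαa hαb
    have key : ∀ {a b : List Bool}, a ∈ M → b ∈ M → initSeg α a.length = a →
        initSeg α b.length = b → ¬ a.length < b.length := by
      intro a b ha hb hαa hαb hl
      refine hb.2 _ hl ?_
      rw [← hαb, take_initSeg α hl.le, hαa]
      exact ha.1
    rw [← hαa, ← hαb, le_antisymm (not_lt.1 (key hb ha hαb hαa)) (not_lt.1 (key ha hb hαa hαb))]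
  rw [hU, measure_biUnion M.to_countable hd fun a _ => measurableSet_cyl a,
    measure_biUnion M.to_countable hd fun a _ => measurableSet_cyl a]
  exact ENNReal.tsum_le_tsum fun a => h a a.2.1

theorem mem_openSet_cyl {W : ℕ × List Bool → Prop} {n : ℕ} {α : Cantor} :
    α ∈ openSet cyl W n ↔ ∃ k, W (n, initSeg α k) := by
  constructor
  · rintro ⟨a, ha, hα⟩
    exact ⟨a.length, by rwa [mem_cyl_iff.1 hα]⟩
  · rintro ⟨k, hk⟩
    exact ⟨_, hk, mem_cyl_initSeg _ _⟩

theorem measurableSet_box (p : List Bool × List Bool) : MeasurableSet (box p) :=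
  (measurableSet_cyl _).prod (measurableSet_cyl _)

theorem disjoint_box {p q : List Bool × List Bool} (h₁ : p.1.length = q.1.length)
    (h₂ : p.2.length = q.2.length) (h : p ≠ q) : Disjoint (box p) (box q) := by
  by_cases h' : p.1 = q.1
  · exact Set.disjoint_prod.2 (Or.inr (disjoint_cyl h₂ fun h'' => h (Prod.ext h' h'')))
  · exact Set.disjoint_prod.2 (Or.inl (disjoint_cyl h₁ h'))

theorem measure_box_nil (P : Measure (Cantor × Cantor)) (a : List Bool) :
    P (box (a, [])) = P.fst (cyl a) := by
  rw [Measure.fst_apply (measurableSet_cyl _), box, cyl_nil, Set.prod_univ]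

/-! ### Conditional measure of sections -/

/-- Sections of an open set whose relative measure is bounded along all prefixes of `α` have
conditional measure with the same bound. -/
theorem IsCondMeasure.measure_section_le {P : Measure (Cantor × Cantor)} [IsProbabilityMeasure P]
    {α : Cantor} {Q : Measure Cantor} (hQ : IsCondMeasure P α Q)
    {D : List Bool × List Bool → Prop} {U : Set (Cantor × Cantor)} {ε : ℝ≥0∞}
    (hD : ∀ p, D p → box p ⊆ U)
    (hU : ∀ k, P (U ∩ cyl (initSeg α k) ×ˢ Set.univ) ≤ ε * P.fst (cyl (initSeg α k))) :
    Q {β | ∃ b, (∃ k, D (initSeg α k, b)) ∧ β ∈ cyl b} ≤ ε := by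
  classical
  -- The section is an increasing union of clopen sets, each a finite disjoint union of cylinders of
  -- one length, to which the limit defining `Q` applies term by term.
  set G : ℕ → Set (List Bool) :=
    fun l => {d | d.length = l ∧ ∃ u k, D (initSeg α k, d.take u)} with hG
  have hfin : ∀ l, (G l).Finite := fun l => (List.finite_length_eq Bool l).subset fun d hd => hd.1
  have hUnion : {β | ∃ b, (∃ k, D (initSeg α k, b)) ∧ β ∈ cyl b} = ⋃ l, ⋃ d ∈ G l, cyl d := by
    ext β
    simp only [Set.mem_ofPred_eq, Set.mem_iUnion, exists_prop]
    constructor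
    · rintro ⟨b, ⟨k, hk⟩, hβ⟩
      exact ⟨b.length, b, ⟨rfl, b.length, k, by simpa using hk⟩, hβ⟩
    · rintro ⟨l, d, ⟨-, u, k, hk⟩, hβ⟩
      exact ⟨_, ⟨k, hk⟩, cyl_subset_cyl_take d u hβ⟩
  have hmono : Monotone fun l => ⋃ d ∈ G l, cyl d := by
    intro l l' hl β hβ
    simp only [Set.mem_iUnion, exists_prop] at hβ ⊢
    obtain ⟨d, ⟨hd, u, k, hk⟩, hβ⟩ := hβ
    refine ⟨initSeg β l', ⟨length_initSeg _ _, min u l, k, ?_⟩, mem_cyl_initSeg _ _⟩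
    rw [← mem_cyl_iff.1 hβ, hd] at hk
    rwa [take_initSeg β (by omega), ← take_initSeg β (min_le_right u l), ← List.take_take,
      List.take_of_length_le (l := initSeg β l) (by rw [length_initSeg])]
  rw [hUnion, hmono.measure_iUnion]
  refine iSup_le fun l => ?_
  have hdisj : (G l).PairwiseDisjoint cyl := fun a ha b hb hab =>
    disjoint_cyl (ha.1.trans hb.1.symm) hab
  have hcoe : ⋃ d ∈ G l, cyl d = ⋃ d ∈ (hfin l).toFinset, cyl d := by simp
  rw [hcoe, measure_biUnion_finset (by simpa using hdisj) fun d _ => measurableSet_cyl d]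
  have hlim := tendsto_finsetSum (hfin l).toFinset fun d _ => hQ.tendsto d
  refine le_of_tendsto hlim ?_
  -- A box lies in `U` once the prefix of `α` is as long as the witness; finitely many `d` permit a
  -- common bound.
  have hev : ∀ d ∈ (hfin l).toFinset, ∀ᶠ k in atTop, box (initSeg α k, d) ⊆ U := by
    intro d hd
    obtain ⟨-, u, k₀, hk₀⟩ := (hfin l).mem_toFinset.1 hd
    filter_upwards [eventually_ge_atTop k₀] with k hk
    exact (Set.prod_mono (cyl_initSeg_anti α hk) (cyl_subset_cyl_take d u)).trans (hD _ hk₀)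
  filter_upwards [(Filter.eventually_all_finset _).2 hev] with k hk
  simp only [ENNReal.div_eq_inv_mul]
  rw [← Finset.mul_sum, ← ENNReal.div_eq_inv_mul,
    ← measure_biUnion_finset _ fun d _ => measurableSet_box _]
  · refine ENNReal.div_le_of_le_mul ((measure_mono ?_).trans (hU k))
    refine Set.iUnion₂_subset fun d hd => Set.subset_inter (hk d hd) ?_
    exact Set.prod_mono subset_rfl (Set.subset_univ _)
  · intro a ha b hb hab
    have ha' := (hfin l).mem_toFinset.1 ha
    have hb' := (hfin l).mem_toFinset.1 hb
    exact disjoint_box rfl (ha'.1.trans hb'.1.symm) fun h => hab (Prod.ext_iff.1 h).2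

/-! ### Approximating the measure of open sets from below -/

theorem computable_sum_range {ι : Type} [Primcodable ι] {g : ι × ℕ → ℕ} (hg : Computable g)
    {n : ι → ℕ} (hn : Computable n) : Computable fun x => ∑ k ∈ Finset.range (n x), g (x, k) := by
  refine (Computable.nat_rec (σ := ℕ) (f := n) (g := fun _ => 0)
    (h := fun x q => q.2 + g (x, q.1)) hn (Computable.const 0) ?_).of_eq fun x => ?_
  · exact (Primrec.nat_add.to_comp.comp (Computable.snd.comp Computable.snd)
      (hg.comp (Computable.fst.pair (Computable.fst.comp Computable.snd)))).to₂
  · induction n x with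
    | zero => rfl
    | succ k ih => rw [Finset.sum_range_succ, ← ih]

/-- The pair of strings with code `k`, provided that it has been enumerated into the `i`-th set by
stage `t`, that its members have length `L`, and that the first one extends `a`. -/
def stageBox (T : (ℕ × (List Bool × List Bool)) × ℕ → Bool) (i : ℕ) (a : List Bool)
    (L t k : ℕ) : Option (List Bool × List Bool) :=
  (Encodable.decode k : Option (List Bool × List Bool)).bind fun p =>
    if (decide (Encodable.encode p = k) && decide (p.1.length = L) && decide (p.2.length = L) &&
      decide (p.1.take a.length = a) && T ((i, p), t)) = true then some p else none

/-- A lower approximation of `2 ^ m` times the total measure of the boxes `stageBox T i a L t k`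
for `k < t`. -/
def stageSum (T : (ℕ × (List Bool × List Bool)) × ℕ → Bool)
    (f : (List Bool × List Bool) × ℕ → ℕ) (i : ℕ) (a : List Bool) (L t m : ℕ) : ℕ :=
  ∑ k ∈ Finset.range t, ((stageBox T i a L t k).map fun p => f (p, m) - 1).getD 0

/-- The union of the boxes `stageBox T i a L t k` for `k < t`. -/
def stageSet (T : (ℕ × (List Bool × List Bool)) × ℕ → Bool) (i : ℕ) (a : List Bool)
    (L t : ℕ) : Set (Cantor × Cantor) :=
  ⋃ k ∈ Finset.range t, {x | ∃ p, stageBox T i a L t k = some p ∧ x ∈ box p}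

theorem stageBox_eq_some {T : (ℕ × (List Bool × List Bool)) × ℕ → Bool} {i : ℕ} {a : List Bool}
    {L t k : ℕ} {p : List Bool × List Bool} :
    stageBox T i a L t k = some p ↔ Encodable.encode p = k ∧ p.1.length = L ∧
      p.2.length = L ∧ p.1.take a.length = a ∧ T ((i, p), t) = true := by
  simp only [stageBox, Option.bind_eq_some_iff]
  constructor
  · rintro ⟨q, hq, h⟩
    split_ifs at h with hc
    obtain rfl := Option.some.inj h
    simpa [and_assoc] using hc
  · rintro h
    refine ⟨p, by rw [← h.1, Encodable.encodek], ?_⟩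
    rw [if_pos (by simpa [and_assoc] using h)]

theorem computable_stageBox {T : (ℕ × (List Bool × List Bool)) × ℕ → Bool} (hT : Computable T)
    {ι : Type} [Primcodable ι] {i : ι → ℕ} {a : ι → List Bool} {L t k : ι → ℕ}
    (hi : Computable i) (ha : Computable a) (hL : Computable L) (ht : Computable t)
    (hk : Computable k) : Computable fun x => stageBox T (i x) (a x) (L x) (t x) (k x) := by
  have hp : Computable fun y : ι × (List Bool × List Bool) => y.2 := Computable.snd
  have hx : Computable fun y : ι × (List Bool × List Bool) => y.1 := Computable.fst
  have heq : Computable₂ fun b c : ℕ => decide (b = c) := Primrec.eq.decide.to_comp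
  have heq' : Computable₂ fun b c : List Bool => decide (b = c) := Primrec.eq.decide.to_comp
  have hand : Computable₂ and := Primrec.and.to_comp
  have htake : Computable₂ (List.take : ℕ → List Bool → List Bool) := Primrec.list_take.to_comp
  have h₀ := heq.comp (Computable.encode.comp hp) (hk.comp hx)
  have h₁ := heq.comp (Computable.list_length.comp (Computable.fst.comp hp)) (hL.comp hx)
  have h₂ := heq.comp (Computable.list_length.comp (Computable.snd.comp hp)) (hL.comp hx)
  have h₃ := heq'.comp (htake.comp (Computable.list_length.comp (ha.comp hx))
    (Computable.fst.comp hp)) (ha.comp hx)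
  have h₄ := hT.comp (((hi.comp hx).pair hp).pair (ht.comp hx))
  refine Computable.option_bind (Computable.decode.comp hk) ?_
  refine Computable.of_eq (Computable.cond
    (hand.comp (hand.comp (hand.comp (hand.comp h₀ h₁) h₂) h₃) h₄)
    (Computable.option_some.comp hp) (Computable.const none)) fun y => ?_
  rw [Bool.cond_eq_ite]

theorem computable_stageSum {T : (ℕ × (List Bool × List Bool)) × ℕ → Bool} (hT : Computable T)
    {f : (List Bool × List Bool) × ℕ → ℕ} (hf : Computable f)
    {ι : Type} [Primcodable ι] {i : ι → ℕ} {a : ι → List Bool} {L t m : ι → ℕ}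
    (hi : Computable i) (ha : Computable a) (hL : Computable L) (ht : Computable t)
    (hm : Computable m) : Computable fun x => stageSum T f (i x) (a x) (L x) (t x) (m x) := by
  have hx : Computable fun y : ι × ℕ => y.1 := Computable.fst
  refine computable_sum_range (g := fun y => ((stageBox T (i y.1) (a y.1) (L y.1) (t y.1) y.2).map
    fun p => f (p, m y.1) - 1).getD 0) ?_ ht
  refine Computable.option_getD (Computable.option_map (computable_stageBox hT (hi.comp hx)
    (ha.comp hx) (hL.comp hx) (ht.comp hx) Computable.snd) ?_) (Computable.const 0)
  exact (Computable.pred.comp (hf.comp (Computable.snd.pair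
    (hm.comp (hx.comp Computable.fst))))).to₂

section Approximation

variable {P : Measure (Cantor × Cantor)}
  {f : (List Bool × List Bool) × ℕ → ℕ}
  {T : (ℕ × (List Bool × List Bool)) × ℕ → Bool} {i : ℕ} {a : List Bool}

/-- Distinct boxes with equal side lengths are disjoint, and the condition on codes in `stageBox`
prevents counting a box twice. -/
theorem toReal_measure_stageSet [IsProbabilityMeasure P] (L t : ℕ) :
    (P (stageSet T i a L t)).toReal = ∑ k ∈ Finset.range t,
      (P {x | ∃ p, stageBox T i a L t k = some p ∧ x ∈ box p}).toReal := by
  rw [stageSet, measure_biUnion_finset, ENNReal.toReal_sum fun _ _ => measure_ne_top _ _]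
  · intro k _ k' _ hkk
    refine Set.disjoint_left.2 ?_
    rintro x ⟨p, hp, hx⟩ ⟨q, hq, hx'⟩
    rw [stageBox_eq_some] at hp hq
    refine Set.disjoint_left.1 (disjoint_box (hp.2.1.trans hq.2.1.symm)
      (hp.2.2.1.trans hq.2.2.1.symm) ?_) hx hx'
    rintro rfl
    exact hkk (hp.1.symm.trans hq.1)
  · intro k _
    cases h : stageBox T i a L t k with
    | none => simp
    | some p => simp [measurableSet_box p]

/-- The value `f (p, m)` exceeds `2 ^ m * P (box p)` by at most `1`, so subtracting `1` gives a
lower bound; truncation at `0` is harmless. -/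
theorem stageSum_le [IsProbabilityMeasure P]
    (hf : ∀ p n, |(P (box p)).toReal - (f (p, n) : ℝ) / 2 ^ n| ≤ 1 / 2 ^ n)
    (L t m : ℕ) : (stageSum T f i a L t m : ℝ) ≤ 2 ^ m * (P (stageSet T i a L t)).toReal := by
  rw [toReal_measure_stageSet, stageSum, Nat.cast_sum, Finset.mul_sum]
  refine Finset.sum_le_sum fun k _ => ?_
  cases h : stageBox T i a L t k with
  | none => simp
  | some p =>
    have h₂ : (0 : ℝ) < 2 ^ m := by positivity
    have h₁ := (abs_le.1 (hf p m)).1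
    have h₃ : (f (p, m) : ℝ) - 1 ≤ 2 ^ m * (P (box p)).toReal := by
      have : 2 ^ m * ((P (box p)).toReal - (f (p, m) : ℝ) / 2 ^ m) ≥ 2 ^ m * (-(1 / 2 ^ m)) := by
        gcongr
      field_simp at this
      linarith
    have : ((f (p, m) - 1 : ℕ) : ℝ) ≤ 2 ^ m * (P (box p)).toReal := by
      rcases Nat.eq_zero_or_pos (f (p, m)) with h0 | h0
      · simp [h0]
      · rwa [Nat.cast_pred h0]
    simpa using this

/-- Each of the `t` terms loses at most `2`: one for the error of `f`, one for the subtraction. The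
loss does not depend on `m`. -/
theorem le_stageSum [IsProbabilityMeasure P]
    (hf : ∀ p n, |(P (box p)).toReal - (f (p, n) : ℝ) / 2 ^ n| ≤ 1 / 2 ^ n)
    (L t m : ℕ) :
    2 ^ m * (P (stageSet T i a L t)).toReal ≤ stageSum T f i a L t m + 2 * t := by
  have : (2 * t : ℝ) = ∑ k ∈ Finset.range t, 2 := by simp [mul_comm]
  rw [toReal_measure_stageSet, stageSum, Nat.cast_sum, Finset.mul_sum, this,
    ← Finset.sum_add_distrib]
  refine Finset.sum_le_sum fun k _ => ?_
  cases h : stageBox T i a L t k with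
  | none => simp
  | some p =>
    have h₂ : (0 : ℝ) < 2 ^ m := by positivity
    have h₁ := (abs_le.1 (hf p m)).2
    have h₃ : 2 ^ m * (P (box p)).toReal ≤ (f (p, m) : ℝ) + 1 := by
      have : 2 ^ m * ((P (box p)).toReal - (f (p, m) : ℝ) / 2 ^ m) ≤ 2 ^ m * (1 / 2 ^ m) := by
        gcongr
      field_simp at this
      linarith
    have h₄ : (f (p, m) : ℝ) ≤ ((f (p, m) - 1 : ℕ) : ℝ) + 1 := by
      exact_mod_cast (by omega : f (p, m) ≤ f (p, m) - 1 + 1)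
    have : 2 ^ m * (P (box p)).toReal ≤ ((f (p, m) - 1 : ℕ) : ℝ) + 2 := by linarith
    simpa using this

variable {W : ℕ × (List Bool × List Bool) → Prop}

theorem stageSet_subset (hT : ∀ x, W x ↔ ∃ s, T (x, s) = true) (L t : ℕ) :
    stageSet T i a L t ⊆ openSet box W i ∩ cyl a ×ˢ Set.univ := by
  refine Set.iUnion₂_subset fun k _ => ?_
  rintro x ⟨p, hp, hx⟩
  rw [stageBox_eq_some] at hp
  refine ⟨⟨p, (hT _).2 ⟨t, hp.2.2.2.2⟩, hx⟩, ?_, trivial⟩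
  rw [← hp.2.2.2.1]
  exact cyl_subset_cyl_take _ _ hx.1

theorem iUnion_stageSet (hT : ∀ x, W x ↔ ∃ s, T (x, s) = true)
    (hmono : ∀ x s t, s ≤ t → T (x, s) = true → T (x, t) = true) (L : ℕ) :
    ⋃ t, stageSet T i a L t = {x | ∃ p : List Bool × List Bool, p.1.length = L ∧
      p.2.length = L ∧ p.1.take a.length = a ∧ W (i, p) ∧ x ∈ box p} := by
  ext x
  simp only [stageSet, Set.mem_iUnion, Set.mem_ofPred_eq, Finset.mem_range, stageBox_eq_some,
    exists_prop]
  constructor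
  · rintro ⟨t, k, -, p, ⟨-, h₁, h₂, h₃, h₄⟩, hx⟩
    exact ⟨p, h₁, h₂, h₃, (hT _).2 ⟨t, h₄⟩, hx⟩
  · rintro ⟨p, h₁, h₂, h₃, h₄, hx⟩
    obtain ⟨s, hs⟩ := (hT _).1 h₄
    -- The stage must be late enough for `p` to be enumerated and must exceed the code of `p`.
    exact ⟨max s (Encodable.encode p + 1), Encodable.encode p, by simp, p,
      ⟨rfl, h₁, h₂, h₃, hmono _ _ _ (le_max_left _ _) hs⟩, hx⟩

theorem monotone_stageSet (hmono : ∀ x s t, s ≤ t → T (x, s) = true → T (x, t) = true) (L : ℕ) :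
    Monotone (stageSet T i a L) := by
  intro s t hst x hx
  simp only [stageSet, Set.mem_iUnion, Set.mem_ofPred_eq, Finset.mem_range, stageBox_eq_some,
    exists_prop] at hx ⊢
  obtain ⟨k, hk, p, ⟨h₀, h₁, h₂, h₃, h₄⟩, hx⟩ := hx
  exact ⟨k, hk.trans_le hst, p, ⟨h₀, h₁, h₂, h₃, hmono _ _ _ hst h₄⟩, hx⟩

/-- Stages exhaust the measure of the part of an open set that lies above a cylinder. -/
theorem exists_lt_measure_stageSet (hT : ∀ x, W x ↔ ∃ s, T (x, s) = true)
    (hmono : ∀ x s t, s ≤ t → T (x, s) = true → T (x, t) = true)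
    (hW : ∀ i c d u v, W (i, (List.take u c, List.take v d)) → W (i, (c, d)))
    {r : ℝ≥0∞} (hr : r < P (openSet box W i ∩ cyl a ×ˢ Set.univ)) :
    ∃ L t, r < P (stageSet T i a L t) := by
  -- Closure under extensions lets boxes be refined to a common side length `L`, so these sets
  -- increase with `L`.
  set G : ℕ → Set (Cantor × Cantor) := fun L => {x | ∃ p : List Bool × List Bool,
    p.1.length = L ∧ p.2.length = L ∧ p.1.take a.length = a ∧ W (i, p) ∧ x ∈ box p} with hG
  have hGmono : Monotone G := by
    rintro L L' hL ⟨α, β⟩ ⟨p, h₁, h₂, h₃, h₄, hα, hβ⟩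
    rw [mem_cyl_iff] at hα hβ
    have hal : a.length ≤ L := by
      rw [← h₃, List.length_take, h₁]
      exact min_le_right _ _
    refine ⟨(initSeg α L', initSeg β L'), length_initSeg _ _, length_initSeg _ _, ?_,
      hW _ _ _ L L ?_, mem_cyl_initSeg _ _, mem_cyl_initSeg _ _⟩
    · rw [take_initSeg α (hal.trans hL), ← take_initSeg α hal, ← h₁, hα, h₃]
    · rw [take_initSeg α hL, take_initSeg β hL]
      rw [h₁] at hα
      rw [h₂] at hβ
      rwa [hα, hβ]
  have hsub : openSet box W i ∩ cyl a ×ˢ Set.univ ⊆ ⋃ L, G L := by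
    rintro ⟨α, β⟩ ⟨⟨⟨c, d⟩, hp, hc, hd⟩, ha, -⟩
    rw [mem_cyl_iff] at hc hd ha
    set L := max a.length (max c.length d.length)
    refine Set.mem_iUnion.2 ⟨L, (initSeg α L, initSeg β L), length_initSeg _ _,
      length_initSeg _ _, ?_, hW _ _ _ c.length d.length ?_, mem_cyl_initSeg _ _,
      mem_cyl_initSeg _ _⟩
    · rw [take_initSeg α (le_max_left _ _), ha]
    · rw [take_initSeg α (by omega), take_initSeg β (by omega)]
      simpa only [hc, hd] using hp
  have h := hr.trans_le (measure_mono hsub)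
  rw [hGmono.measure_iUnion, lt_iSup_iff] at h
  obtain ⟨L, hL⟩ := h
  simp only [hG] at hL
  rw [← iUnion_stageSet hT hmono, (monotone_stageSet hmono L).measure_iUnion, lt_iSup_iff] at hL
  exact ⟨L, hL⟩

/-- A strict inequality is witnessed by an upper approximation of the left side and a lower one of
the right side, which makes it a search over a decidable relation. -/
theorem exists_stageSum_iff [IsProbabilityMeasure P]
    (hf : ∀ p n, |(P (box p)).toReal - (f (p, n) : ℝ) / 2 ^ n| ≤ 1 / 2 ^ n)
    (hT : ∀ x, W x ↔ ∃ s, T (x, s) = true)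
    (hmono : ∀ x s t, s ≤ t → T (x, s) = true → T (x, t) = true)
    (hW : ∀ i c d u v, W (i, (List.take u c, List.take v d)) → W (i, (c, d))) (n : ℕ) :
    P.fst (cyl a) < 2 ^ n * P (openSet box W i ∩ cyl a ×ˢ Set.univ) ↔
      ∃ L t m, f ((a, []), m) + 1 < 2 ^ n * stageSum T f i a L t m := by
  rw [← measure_box_nil]
  have h2n : (2 : ℝ≥0∞) ^ n ≠ ∞ := by finiteness
  constructor
  · intro h
    have h' : P (box (a, [])) / 2 ^ n < P (openSet box W i ∩ cyl a ×ˢ Set.univ) := by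
      rw [mul_comm] at h
      exact ENNReal.div_lt_of_lt_mul h
    obtain ⟨L, t, hLt⟩ := exists_lt_measure_stageSet hT hmono hW h'
    rw [ENNReal.div_lt_iff (by simp) (by simp), ← ENNReal.toReal_lt_toReal (measure_ne_top _ _)
      (by finiteness), ENNReal.toReal_mul] at hLt
    simp only [ENNReal.toReal_pow, ENNReal.toReal_ofNat] at hLt
    -- The precision `m` makes `2 ^ m` times the gap exceed all errors: `2 ^ n * (2 * t)` from
    -- `le_stageSum`, and `2` from `f` and the added `1`.
    obtain ⟨m, hm⟩ := pow_unbounded_of_one_lt ((2 ^ n * (2 * t) + 2) /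
      ((P (stageSet T i a L t)).toReal * 2 ^ n - (P (box (a, []))).toReal)) one_lt_two
    refine ⟨L, t, m, ?_⟩
    rw [div_lt_iff₀ (by linarith)] at hm
    have h₁ := le_stageSum (T := T) (i := i) (a := a) hf L t m
    have h₂ := (abs_le.1 (hf (a, []) m)).1
    have h₃ : (f ((a, []), m) : ℝ) - 1 ≤ 2 ^ m * (P (box (a, []))).toReal := by
      have : 2 ^ m * ((P (box (a, []))).toReal - (f ((a, []), m) : ℝ) / 2 ^ m) ≥
          2 ^ m * (-(1 / 2 ^ m)) := by
        gcongr
      field_simp at this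
      linarith
    have h₄ := mul_le_mul_of_nonneg_left h₁ (by positivity : (0 : ℝ) ≤ 2 ^ n)
    have : (f ((a, []), m) : ℝ) + 1 < 2 ^ n * stageSum T f i a L t m := by linarith
    exact_mod_cast this
  · rintro ⟨L, t, m, h⟩
    have h' : (f ((a, []), m) : ℝ) + 1 < 2 ^ n * stageSum T f i a L t m := by exact_mod_cast h
    have h₁ := stageSum_le (T := T) (i := i) (a := a) hf L t m
    have h₂ := (abs_le.1 (hf (a, []) m)).2
    have h₃ : 2 ^ m * (P (box (a, []))).toReal ≤ (f ((a, []), m) : ℝ) + 1 := by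
      have : 2 ^ m * ((P (box (a, []))).toReal - (f ((a, []), m) : ℝ) / 2 ^ m) ≤
          2 ^ m * (1 / 2 ^ m) := by
        gcongr
      field_simp at this
      linarith
    have h₄ := mul_le_mul_of_nonneg_left h₁ (by positivity : (0 : ℝ) ≤ 2 ^ n)
    have h₅ : (P (box (a, []))).toReal < 2 ^ n * (P (stageSet T i a L t)).toReal := by
      refine lt_of_mul_lt_mul_left (a := (2 : ℝ) ^ m) ?_ (by positivity)
      linarith
    have h₆ : P (box (a, [])) < 2 ^ n * P (stageSet T i a L t) := by
      rw [← ENNReal.toReal_lt_toReal (measure_ne_top _ _) (by finiteness), ENNReal.toReal_mul]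
      simpa using h₅
    refine h₆.trans_le ?_
    gcongr
    exact stageSet_subset hT L t

end Approximation

/-! ### The test of heavy strings -/

/-- Every enumerable family of boxes can be closed under extensions of the strings. -/
theorem exists_extension_closed {W : ℕ × (List Bool × List Bool) → Prop} (hW : REPredIn ∅ W) :
    ∃ W' : ℕ × (List Bool × List Bool) → Prop, REPredIn ∅ W' ∧
      (∀ i c d u v, W' (i, (List.take u c, List.take v d)) → W' (i, (c, d))) ∧
      ∀ n, openSet box W' n = openSet box W n := by
  refine ⟨fun x => ∃ u v, W (x.1, (x.2.1.take u, x.2.2.take v)), ?_, ?_, fun n => ?_⟩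
  · obtain ⟨T, hT, h, -⟩ := hW.exists_stage
    have htake : Computable₂ (List.take : ℕ → List Bool → List Bool) := Primrec.list_take.to_comp
    refine REPredIn.of_exists_primcodable (τ := (ℕ × ℕ) × ℕ)
      (F := fun y => T ((y.1.1, (y.1.2.1.take y.2.1.1, y.1.2.2.take y.2.1.2)), y.2.2)) ?_ ?_
    · have hx : Computable fun y : (ℕ × (List Bool × List Bool)) × ((ℕ × ℕ) × ℕ) => y.1 :=
        Computable.fst
      have ht : Computable fun y : (ℕ × (List Bool × List Bool)) × ((ℕ × ℕ) × ℕ) => y.2 :=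
        Computable.snd
      exact hT.comp (((Computable.fst.comp hx).pair
        ((htake.comp (Computable.fst.comp (Computable.fst.comp ht))
          (Computable.fst.comp (Computable.snd.comp hx))).pair
        (htake.comp (Computable.snd.comp (Computable.fst.comp ht))
          (Computable.snd.comp (Computable.snd.comp hx))))).pair (Computable.snd.comp ht))
    · intro x
      simp only [h]
      exact ⟨fun ⟨u, v, s, hs⟩ => ⟨((u, v), s), hs⟩, fun ⟨⟨⟨u, v⟩, s⟩, hs⟩ => ⟨u, v, s, hs⟩⟩
  · rintro i c d u v ⟨u', v', h⟩
    exact ⟨min u' u, min v' v, by simpa only [List.take_take] using h⟩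
  · ext x
    constructor
    · rintro ⟨⟨c, d⟩, ⟨u, v, h⟩, hx⟩
      exact ⟨_, h, cyl_subset_cyl_take c u hx.1, cyl_subset_cyl_take d v hx.2⟩
    · rintro ⟨⟨c, d⟩, h, hx⟩
      exact ⟨(c, d), ⟨c.length, d.length, by simpa using h⟩, hx⟩

/-- The strings above which one of the sets with index `2 * n`, `n > N`, has relative measure
greater than `2⁻¹ ^ n`. -/
def HeavyString (P : Measure (Cantor × Cantor)) (W : ℕ × (List Bool × List Bool) → Prop)
    (x : ℕ × List Bool) : Prop :=
  ∃ j, P.fst (cyl x.2) <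
    2 ^ (x.1 + 1 + j) * P (openSet box W (2 * (x.1 + 1 + j)) ∩ cyl x.2 ×ˢ Set.univ)

theorem rePredIn_heavyString {P : Measure (Cantor × Cantor)} [IsProbabilityMeasure P]
    (hP : ComputableMeasure P) {W : ℕ × (List Bool × List Bool) → Prop} (hW : REPredIn ∅ W)
    (hext : ∀ i c d u v, W (i, (List.take u c, List.take v d)) → W (i, (c, d))) :
    REPredIn ∅ (HeavyString P W) := by
  obtain ⟨f, hf, hfP⟩ := hP
  obtain ⟨T, hT, hTW, hmono⟩ := hW.exists_stage
  refine REPredIn.of_exists_primcodable (τ := (ℕ × ℕ) × (ℕ × ℕ))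
    (F := fun y => decide (f ((y.1.2, []), y.2.2.2) + 1 < 2 ^ (y.1.1 + 1 + y.2.1.1) *
      stageSum T f (2 * (y.1.1 + 1 + y.2.1.1)) y.1.2 y.2.1.2 y.2.2.1 y.2.2.2)) ?_ fun x => ?_
  · have hlt : Computable₂ fun b c : ℕ => decide (b < c) := Primrec.nat_lt.decide.to_comp
    have hadd : Computable₂ fun b c : ℕ => b + c := Primrec.nat_add.to_comp
    have hmul : Computable₂ fun b c : ℕ => b * c := Primrec.nat_mul.to_comp
    have hpow : Computable fun b : ℕ => 2 ^ b := by
      refine (Computable.nat_rec (σ := ℕ) (f := fun b : ℕ => b) (g := fun _ => 1)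
        (h := fun _ q => q.2 * 2) Computable.id (Computable.const 1) ?_).of_eq fun b => ?_
      · exact (hmul.comp (Computable.snd.comp Computable.snd) (Computable.const 2)).to₂
      · induction b with
        | zero => rfl
        | succ b ih => rw [pow_succ, ← ih]
    have hx : Computable fun y : (ℕ × List Bool) × ((ℕ × ℕ) × (ℕ × ℕ)) => y.1 := Computable.fst
    have ht : Computable fun y : (ℕ × List Bool) × ((ℕ × ℕ) × (ℕ × ℕ)) => y.2 := Computable.snd
    have ha := Computable.snd.comp hx
    have hL := Computable.snd.comp (Computable.fst.comp ht)
    have hs := Computable.fst.comp (Computable.snd.comp ht)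
    have hm := Computable.snd.comp (Computable.snd.comp ht)
    have hn := hadd.comp (Computable.succ.comp (Computable.fst.comp hx))
      (Computable.fst.comp (Computable.fst.comp ht))
    exact hlt.comp (Computable.succ.comp (hf.comp ((ha.pair (Computable.const [])).pair hm)))
      (hmul.comp (hpow.comp hn)
        (computable_stageSum hT hf (hmul.comp (Computable.const 2) hn) ha hL hs hm))
  · simp only [HeavyString, exists_stageSum_iff hfP hTW hmono hext, decide_eq_true_eq]
    exact ⟨fun ⟨j, L, t, m, h⟩ => ⟨((j, L), (t, m)), h⟩,
      fun ⟨⟨⟨j, L⟩, (t, m)⟩, h⟩ => ⟨j, L, t, m, h⟩⟩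

theorem measure_heavyString_le {P : Measure (Cantor × Cantor)}
    {W : ℕ × (List Bool × List Bool) → Prop}
    (hW : ∀ n, P (openSet box W n) ≤ (2⁻¹ : ℝ≥0∞) ^ n) (N : ℕ) :
    P.fst (openSet cyl (HeavyString P W) N) ≤ (2⁻¹ : ℝ≥0∞) ^ N := by
  have hU : openSet cyl (HeavyString P W) N = ⋃ j, ⋃ a ∈ {a | P.fst (cyl a) <
      2 ^ (N + 1 + j) * P (openSet box W (2 * (N + 1 + j)) ∩ cyl a ×ˢ Set.univ)}, cyl a := by
    ext α
    simp only [openSet, HeavyString, Set.mem_iUnion, Set.mem_ofPred_eq, exists_prop]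
    exact ⟨fun ⟨a, ⟨j, h⟩, hα⟩ => ⟨j, a, h, hα⟩, fun ⟨j, a, h, hα⟩ => ⟨a, ⟨j, h⟩, hα⟩⟩
  have hj : ∀ j, P.fst (⋃ a ∈ {a | P.fst (cyl a) <
      2 ^ (N + 1 + j) * P (openSet box W (2 * (N + 1 + j)) ∩ cyl a ×ˢ Set.univ)}, cyl a) ≤
      (2⁻¹ : ℝ≥0∞) ^ (N + 1 + j) := by
    intro j
    generalize N + 1 + j = n
    -- The comparison measure is `2 ^ n` times the first marginal of `P` restricted to the open set;
    -- the index `2 * n` absorbs this factor.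
    refine (measure_biUnion_cyl_le P.fst
      ((2 : ℝ≥0∞) ^ n • (P.restrict (openSet box W (2 * n))).fst) _ fun a ha => ?_).trans ?_
    · have hr : (P.restrict (openSet box W (2 * n))).fst (cyl a) =
          P (openSet box W (2 * n) ∩ cyl a ×ˢ Set.univ) := by
        rw [Measure.fst_apply (measurableSet_cyl a), Measure.restrict_apply
          (measurable_fst (measurableSet_cyl a)), Set.inter_comm, ← Set.prod_univ]
      rw [Measure.smul_apply, hr, smul_eq_mul]
      exact (Set.mem_ofPred.1 ha).le
    · refine (measure_mono (Set.subset_univ _)).trans ?_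
      rw [Measure.smul_apply, Measure.fst_univ, Measure.restrict_apply_univ, smul_eq_mul]
      calc (2 : ℝ≥0∞) ^ n * P (openSet box W (2 * n)) ≤ 2 ^ n * 2⁻¹ ^ (2 * n) := by
            gcongr
            exact hW _
        _ = 2⁻¹ ^ n := by
            rw [two_mul, pow_add, ← mul_assoc, ← mul_pow,
              ENNReal.mul_inv_cancel (by simp) (by simp), one_pow, one_mul]
  rw [hU]
  calc _ ≤ ∑' j, (2⁻¹ : ℝ≥0∞) ^ (N + 1 + j) :=
        (measure_iUnion_le _).trans (ENNReal.tsum_le_tsum hj)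
    _ = 2⁻¹ ^ N := by
        simp_rw [pow_add _ (N + 1)]
        rw [ENNReal.tsum_mul_left, ENNReal.tsum_geometric, ENNReal.one_sub_inv_two, inv_inv,
          pow_succ, mul_assoc, ENNReal.inv_mul_cancel (by simp) (by simp), mul_one]

/-! ### The test of sections and the conclusion -/

theorem rePredIn_section {W : ℕ × (List Bool × List Bool) → Prop} (hW : REPredIn ∅ W)
    (α : Cantor) (N : ℕ) :
    REPredIn {oracle α} fun x : ℕ × List Bool =>
      ∃ k, W (2 * (N + 1 + x.1), (initSeg α k, x.2)) := by
  obtain ⟨T, hT, h, -⟩ := hW.exists_stage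
  refine REPredIn.of_exists
    (F := fun y => T ((2 * (N + 1 + y.1.1), (initSeg α y.2.unpair.1, y.1.2)), y.2.unpair.2))
    (ComputableIn.comp_computable hT ?_) fun x => ?_
  · have hmul : Primrec fun n : ℕ => 2 * (N + 1 + n) := Primrec.nat_mul.comp (Primrec.const 2)
      (Primrec.nat_add.comp (Primrec.const (N + 1)) Primrec.id)
    have hu : Primrec fun y : (ℕ × List Bool) × ℕ => y.2.unpair := Primrec.unpair.comp Primrec.snd
    exact ComputableIn.prodMk (ComputableIn.prodMk
      (hmul.comp (Primrec.fst.comp Primrec.fst)).computableIn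
      (ComputableIn.prodMk
        (ComputableIn.comp (computableIn_initSeg α) (Primrec.fst.comp hu).computableIn)
        (Primrec.snd.comp Primrec.fst).computableIn)) (Primrec.snd.comp hu).computableIn
  · simp only [h]
    exact ⟨fun ⟨k, s, hs⟩ => ⟨Nat.pair k s, by simpa using hs⟩, fun ⟨t, ht⟩ => ⟨_, _, ht⟩⟩

end VanLambalgen

theorem mainTheorem3 (P : MeasureTheory.Measure (VanLambalgen.Cantor × VanLambalgen.Cantor))
    [MeasureTheory.IsProbabilityMeasure P] (hP : VanLambalgen.ComputableMeasure P)
    (α₁ α₂ : VanLambalgen.Cantor)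
    (h₁ : VanLambalgen.MLRandom P.fst α₁)
    (h₂ : VanLambalgen.BlindRandom α₁ (VanLambalgen.condMeasure P α₁) α₂) :
    VanLambalgen.MLRandomPair P (α₁, α₂) := by
  open VanLambalgen in
  intro W₀ hW₀
  obtain ⟨W, hW, hext, hWW⟩ := exists_extension_closed hW₀.enumerable
  have hle : ∀ n, P (openSet box W n) ≤ (2⁻¹ : ℝ≥0∞) ^ n := fun n => hWW n ▸ hW₀.measure_le n
  simp only [← hWW]
  obtain ⟨N, hN⟩ := h₁ _ ⟨rePredIn_heavyString hP hW hext, measure_heavyString_le hle⟩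
  simp only [mem_openSet_cyl, HeavyString, not_exists, not_lt] at hN
  -- Without a limit distribution `condMeasure` is zero, and then `α₂` could not be random.
  have hex : ∃ Q, IsCondMeasure P α₁ Q := by
    by_contra hex
    rw [condMeasure, dif_neg hex] at h₂
    exact not_blindRandom_zero _ _ h₂
  obtain ⟨Q, hQ⟩ := hex
  rw [condMeasure_eq hQ] at h₂
  have htest : IsTest cyl {oracle α₁} Q
      fun x => ∃ k, W (2 * (N + 1 + x.1), (initSeg α₁ k, x.2)) := by
    refine ⟨rePredIn_section hW α₁ N, fun j => ?_⟩
    -- The bound `2⁻¹ ^ (N + 1 + j)` is stronger than the `2⁻¹ ^ j` that a test requires.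
    refine (hQ.measure_section_le (ε := 2⁻¹ ^ (N + 1 + j))
      (D := fun p => W (2 * (N + 1 + j), p)) (U := openSet box W (2 * (N + 1 + j)))
      (fun p hp x hx => ⟨p, hp, hx⟩) fun k => ?_).trans
      (pow_le_pow_right_of_le_one' (by simp) (by omega))
    rw [← ENNReal.inv_pow, ← ENNReal.div_eq_inv_mul, ENNReal.le_div_iff_mul_le (by simp) (by simp),
      mul_comm]
    exact hN k j
  obtain ⟨j, hj⟩ := h₂ _ htest
  -- If a box contains the pair, its first string is a prefix of `α₁`, so its second string belongs
  -- to the section.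
  refine ⟨2 * (N + 1 + j), fun ⟨⟨c, d⟩, hp, hc, hd⟩ => hj ⟨d, ⟨c.length, ?_⟩, hd⟩⟩
  rwa [mem_cyl_iff.1 hc]
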